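/- Let $\log$ denote the logarithm to base $2$. For positive integers $n,k$ consider $n$ men and $n$ women. Each participant $x$ has a profile $\mathbf a(x)\in\{0,1\}^k$ and a tie-breaking list $T_x$, an ordering of the members of the opposite side; all $2n$ profiles and all $2n$ lists are independent and uniformly distributed. The distance of two participants is the weighted Hamming distance of their profiles, $d(x,y)=\sum_{i=1}^k 2^{-i}\,\mathbf 1\bigl(a_i(x)\ne a_i(y)\bigr)$. Each participant ranks the members of the opposite side by increasing distance, and members at the same distance in the order of $T_x$. A matching $\mu$ is a map from the set of participants to itself that sends each man to a woman or to himself, each woman to a man or to herself, and satisfies $\mu(x)=y\Rightarrow\mu(y)=x$. It is stable if there is no man $m$ and woman $w$ who strictly prefer each other to $\mu(m)$ and $\mu(w)$ respectively, where being unmatched is worse than having any partner. A stable partner of $x$ is a member of the opposite side to whom $x$ is matched in some stable matching. In every instance there is a stable matching, and for every participant $x$ the distance $d(x,\mu(x))$ is the same for all stable matchings $\mu$; it is called the matching distance of $x$. Let $X$ be the matching distance of a uniformly random participant, chosen independently of the profiles and lists. Fix $\epsilon>0$ and a sequence $k=k(n)$ of natural numbers. (i) If $k(n)>(1+\epsilon)\log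 n$ for all sufficiently large $n$, then as $n\to\infty$ the fraction of the $2n$ participants that have more than one stable partner tends to $0$ in probability, and $\log X/\log n\to-1$ in probability (in particular $\mathbb P(X>0)\to1$; $\log X=-\infty$ if $X=0$). (ii) If $k(n)>(2+\epsilon)\log n$ for all sufficiently large $n$, then with probability tending to $1$ as $n\to\infty$ the profiles are such that the stable matching is unique without resorting to tie-breaking: there is one matching that is the only stable matching for every choice of the tie-breaking lists. -/

import Mathlib

open Filter Topology

noncomputable section

/-- The participants: `Sum.inl i` is the `i`-th man, `Sum.inr j` is the `j`-th woman. -/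
abbrev Person (n : ℕ) : Type := Fin n ⊕ Fin n

/-- The `j`-th member of the side opposite to a participant. -/
def opposite {n : ℕ} : Person n → Fin n → Person n
  | Sum.inl _, j => Sum.inr j
  | Sum.inr _, j => Sum.inl j

/-- Each participant's `k`-bit profile, a point of the hypercube. -/
abbrev Profiles (n k : ℕ) : Type := Person n → Fin k → Bool

/-- Each participant's tie-breaking list: `T x j` is the position of the `j`-th member of the
opposite side in the list of `x` (a smaller position is better). -/
abbrev TieLists (n : ℕ) : Type := Person n → Equiv.Perm (Fin n)

/-- An instance of the profile matching problem: profiles together with tie-breaking lists. -/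
abbrev Market (n k : ℕ) : Type := Profiles n k × TieLists n

/-- Weighted Hamming distance `∑_{i=1}^k 2^{-i} 1(a_i ≠ b_i)`; the index `i : Fin k` starts
at `0`, whence the exponent `i + 1`. -/
def weightedHamming {k : ℕ} (a b : Fin k → Bool) : ℝ :=
  ∑ i : Fin k, if a i ≠ b i then (1 / 2 : ℝ) ^ ((i : ℕ) + 1) else 0

/-- Distance between two participants: the distance between their profiles. -/
def personDist {n k : ℕ} (a : Profiles n k) (x y : Person n) : ℝ :=
  weightedHamming (a x) (a y)

/-- The strict preference list of `x`: the `i`-th member of the opposite side is preferred to the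
`j`-th one if closer, or at the same distance and earlier in the tie-breaking list of `x`. -/
def Prefers {n k : ℕ} (M : Market n k) (x : Person n) (i j : Fin n) : Prop :=
  personDist M.1 x (opposite x i) < personDist M.1 x (opposite x j) ∨
    (personDist M.1 x (opposite x i) = personDist M.1 x (opposite x j) ∧ M.2 x i < M.2 x j)

/-- A (possibly partial) matching: a map from the participants to themselves sending each man to
a woman or to himself and each woman to a man or to herself, with `μ x = y → μ y = x`.
Participants with `μ x = x` are unmatched. -/
@[ext]
structure Matching (n : ℕ) where
  toFun : Person n → Person n
  self_or_opposite : ∀ x, toFun x = x ∨ ∃ j, toFun x = opposite x j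
  symm : ∀ x y, toFun x = y → toFun y = x

/-- Under `μ`, participant `x` would rather be matched with the `j`-th member of the opposite
side: `x` prefers that member to the present partner, if there is one (being unmatched is
worse than having any partner). -/
def WouldSwitch {n k : ℕ} (M : Market n k) (μ : Matching n) (x : Person n) (j : Fin n) : Prop :=
  ∀ i, μ.toFun x = opposite x i → Prefers M x j i

/-- The `i`-th man and the `j`-th woman form a blocking pair for `μ`. -/
def IsBlockingPair {n k : ℕ} (M : Market n k) (μ : Matching n) (i j : Fin n) : Prop :=
  WouldSwitch M μ (Sum.inl i) j ∧ WouldSwitch M μ (Sum.inr j) i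

/-- A matching is stable if it has no blocking pair. -/
def IsStable {n k : ℕ} (M : Market n k) (μ : Matching n) : Prop :=
  ∀ i j, ¬ IsBlockingPair M μ i j

/-- The stable partners of `x`: the members of the opposite side to whom `x` is matched in some
stable matching. -/
def stablePartners {n k : ℕ} (M : Market n k) (x : Person n) : Set (Fin n) :=
  {j | ∃ μ, IsStable M μ ∧ μ.toFun x = opposite x j}

/-- The fraction of the `2n` participants that have more than one stable partner. -/
def multipleFraction {n k : ℕ} (M : Market n k) : ℝ :=
  ({x : Person n | (stablePartners M x).Nontrivial}.ncard : ℝ) / (2 * n)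

open Classical in
/-- The matching distance of `x`: the distance from `x` to the partner of `x` in a stable matching
(a stable matching always exists, and the distance is the same for all of them). -/
def matchingDistance {n k : ℕ} (M : Market n k) (x : Person n) : ℝ :=
  if h : ∃ μ, IsStable M μ then personDist M.1 x (h.choose.toFun x) else 0

/-- With these profiles the stable matching is unique without resorting to tie-breaking:
there is one matching which, for every choice of the tie-breaking lists, is the only
stable matching. -/
def UniqueWithoutTieBreaking {n k : ℕ} (a : Profiles n k) : Prop :=
  ∃ μ : Matching n, ∀ (T : TieLists n) (ν : Matching n), IsStable (a, T) ν ↔ ν = μ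

/-- Probability of an event under the uniform distribution on a finite type. On a finite product
this is the law of independent uniform coordinates. -/
def uniformProb {Ω : Type} (A : Set Ω) : ℝ := (A.ncard : ℝ) / (Nat.card Ω : ℝ)

end

/-! Distances, and hence preferences up to tie-breaking, are symmetric. Given two stable matchings
`μ` and `ν`, the participants who prefer `μ` and those who prefer `ν` are exchanged by `μ` and by
`ν`, so their total distances agree and no single distance can differ. As the distance from a
given profile determines the other profile, a participant with several stable partners has
partners with equal profiles; on average at most `(2n)² / 2ᵏ` ordered pairs of participants have
equal profiles.

The same count of pairs shows that few participants are matched much closer than `1 / n`. For the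
other direction, among the participants with a given `j`-bit prefix those matched at distance at
least `2⁻ʲ` are all on one side, so their number is at most the imbalance between men and women
with this prefix. The squared imbalances over all prefixes sum to at most `2n` on average, and by
Cauchy–Schwarz the fraction of participants matched at distance at least `2⁻ʲ` has mean at most
`√(2ʲ / 2n)`. -/

section StableMatchings

variable {α β γ δ : Type*} [LinearOrder γ] [LinearOrder δ]

/-- `AtLeastAsGood p X a b`: with the preferences of `a` given by the scores `p a` (smaller is
better), `b` is at least as good as every option that `X` offers to `a`. -/
def AtLeastAsGood (p : α → β → γ) (X : α → β → Prop) (a : α) (b : β) : Prop :=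
  ∀ c, X a c → p a b ≤ p a c

lemma atLeastAsGood_antitone (p : α → β → γ) : Antitone (AtLeastAsGood p) :=
  fun _ _ hXY _ _ h c hc => h c (hXY _ _ hc)

lemma exists_atLeastAsGood_le [Finite β] (p : α → β → γ) {X : α → β → Prop} {a : α} {b : β}
    (hb : X a b) : ∃ c, X a c ∧ AtLeastAsGood p X a c ∧ p a c ≤ p a b := by
  obtain ⟨c, hc, hmin⟩ := Set.exists_min_image {c | X a c} (p a) (Set.toFinite _) ⟨b, hb⟩
  exact ⟨c, hc, hmin, hmin b hb⟩

theorem exists_stable_relation [Finite α] [Finite β] {p : α → β → γ} {q : β → α → δ}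
    (hp : ∀ a, (p a).Injective) (hq : ∀ b, (q b).Injective) :
    ∃ R : α → β → Prop, (∀ a b c, R a b → R a c → b = c) ∧ (∀ a c b, R a b → R c b → a = c) ∧
      ∀ a b, (∃ c, R a c ∧ p a c ≤ p a b) ∨ ∃ c, R c b ∧ q b c ≤ q b a := by
  -- A fixed point of the Gale–Shapley operator: `X` holds the pairs that the `β` side has not
  -- rejected, `Y` the pairs that the `α` side would propose given `X`.
  let F : (α → β → Prop) →o (α → β → Prop) :=
    ⟨fun X => flip (AtLeastAsGood q (flip (AtLeastAsGood p X))), fun _ _ h a b =>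
      atLeastAsGood_antitone q (fun b a => atLeastAsGood_antitone p h a b) b a⟩
  set X := F.lfp
  set Y := AtLeastAsGood p X
  have hX : ∀ a b, X a b ↔ AtLeastAsGood q (flip Y) b a := fun a b =>
    (congr_fun₂ F.map_lfp a b).symm.to_iff
  refine ⟨fun a b => X a b ∧ Y a b, ?_, ?_, fun a b => ?_⟩
  · rintro a b c ⟨hXb, hYb⟩ ⟨hXc, hYc⟩
    exact hp a ((hYb c hXc).antisymm (hYc b hXb))
  · rintro a c b ⟨hXa, hYa⟩ ⟨hXc, hYc⟩
    exact hq b (((hX a b).1 hXa c hYc).antisymm ((hX c b).1 hXc a hYa))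
  · by_cases hab : X a b
    · obtain ⟨c, hXc, hYc, hc⟩ := exists_atLeastAsGood_le p hab
      exact Or.inl ⟨c, ⟨hXc, hYc⟩, hc⟩
    · obtain ⟨d, hYd, hd⟩ : ∃ d, Y d b ∧ q b d < q b a := by
        simpa [hX, AtLeastAsGood, flip] using hab
      obtain ⟨c, hYc, hXc, hc⟩ := exists_atLeastAsGood_le q (X := flip Y) hYd
      exact Or.inr ⟨c, ⟨(hX c b).2 hXc, hYc⟩, hc.trans hd.le⟩

theorem exists_stable_equiv [Fintype α] [Fintype β] (hcard : Fintype.card α = Fintype.card β)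
    {p : α → β → γ} {q : β → α → δ} (hp : ∀ a, (p a).Injective) (hq : ∀ b, (q b).Injective) :
    ∃ σ : α ≃ β, ∀ a b, p a (σ a) ≤ p a b ∨ q b (σ.symm b) ≤ q b a := by
  obtain ⟨R, hfun, hinj, hstable⟩ := exists_stable_relation hp hq
  have htotal : ∀ a, ∃ b, R a b := by
    by_contra! ⟨a, ha⟩
    have hmatched : ∀ b, ∃ c, R c b := fun b =>
      ((hstable a b).resolve_left fun ⟨c, hc, _⟩ => ha c hc).imp fun _ => And.left
    choose g hg using hmatched
    have hg_inj : g.Injective := fun b c h => hfun _ b c (hg b) (h ▸ hg c)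
    obtain ⟨b, rfl⟩ := ((Fintype.bijective_iff_injective_and_card g).2 ⟨hg_inj, hcard.symm⟩).2 a
    exact ha b (hg b)
  choose f hf using htotal
  have hf_inj : f.Injective := fun a c h => hinj a c _ (hf a) (h ▸ hf c)
  let σ := Equiv.ofBijective f ((Fintype.bijective_iff_injective_and_card f).2 ⟨hf_inj, hcard⟩)
  refine ⟨σ, fun a b => (hstable a b).imp ?_ ?_⟩
  · rintro ⟨c, hc, hle⟩
    rwa [show σ a = c from hfun a _ _ (hf a) hc]
  · rintro ⟨c, hc, hle⟩
    rwa [show σ.symm b = c from σ.symm_apply_eq.2 (hfun c _ _ hc (hf c))]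

/-- Two groups exchange their roles under both involutions, so each total distance along `μ`
equals the other one up to reordering: if no member of either group loses, none gains. -/
theorem eq_of_forall_le_of_involutive {V R : Type*} [AddCommMonoid R] [PartialOrder R]
    [IsOrderedCancelAddMonoid R] {d : V → V → R} (hd : ∀ x y, d x y = d y x) {μ ν : V → V}
    (hμ : μ.Involutive) (hν : ν.Involutive) {A B : Finset V} (hAB : ∀ x ∈ A, μ x ∈ B)
    (hBA : ∀ x ∈ B, ν x ∈ A) (hA : ∀ x ∈ A, d x (μ x) ≤ d x (ν x))
    (hB : ∀ x ∈ B, d x (ν x) ≤ d x (μ x)) : ∀ x ∈ A, d x (μ x) = d x (ν x) := by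
  have hle : A.card ≤ B.card := Finset.card_le_card_of_injOn μ hAB hμ.injective.injOn
  have hge : B.card ≤ A.card := Finset.card_le_card_of_injOn ν hBA hν.injective.injOn
  have hsumμ : ∑ x ∈ A, d x (μ x) = ∑ x ∈ B, d x (μ x) :=
    Finset.sum_nbij μ hAB hμ.injective.injOn
      (Finset.surjOn_of_injOn_of_card_le μ hAB hμ.injective.injOn hge) fun x _ => by rw [hμ x, hd]
  have hsumν : ∑ x ∈ B, d x (ν x) = ∑ x ∈ A, d x (ν x) :=
    Finset.sum_nbij ν hBA hν.injective.injOn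
      (Finset.surjOn_of_injOn_of_card_le ν hBA hν.injective.injOn hle) fun x _ => by rw [hν x, hd]
  refine (Finset.sum_eq_sum_iff_of_le hA).1 ((Finset.sum_le_sum hA).antisymm ?_)
  rw [hsumμ, ← hsumν]
  exact Finset.sum_le_sum hB

end StableMatchings

section WeightedHamming

variable {k : ℕ}

lemma weightedHamming_nonneg (a b : Fin k → Bool) : 0 ≤ weightedHamming a b :=
  Finset.sum_nonneg fun i _ => by split_ifs <;> positivity

lemma weightedHamming_comm (a b : Fin k → Bool) : weightedHamming a b = weightedHamming b a := by
  simp only [weightedHamming, ne_comm]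

lemma weightedHamming_succ (a b : Fin (k + 1) → Bool) :
    weightedHamming a b =
      ((if a 0 = b 0 then 0 else 1) + weightedHamming (Fin.tail a) (Fin.tail b)) / 2 := by
  simp only [weightedHamming, Fin.sum_univ_succ, Fin.tail, add_div, Finset.sum_div, ite_not,
    Fin.val_zero, Fin.val_succ, ite_div, zero_div, pow_succ _ (_ + 1)]
  norm_num [div_eq_mul_inv]

lemma weightedHamming_lt_one (a b : Fin k → Bool) : weightedHamming a b < 1 := by
  induction k with
  | zero => simp [weightedHamming]
  | succ k ih =>
    rw [weightedHamming_succ]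
    have := ih (Fin.tail a) (Fin.tail b)
    split_ifs <;> linarith

lemma weightedHamming_right_injective (a : Fin k → Bool) : (weightedHamming a).Injective := by
  induction k with
  | zero => exact fun b c _ => Subsingleton.elim _ _
  | succ k ih =>
    intro b c h
    rw [weightedHamming_succ, weightedHamming_succ] at h
    have hb := weightedHamming_lt_one (Fin.tail a) (Fin.tail b)
    have hc := weightedHamming_lt_one (Fin.tail a) (Fin.tail c)
    have hb0 := weightedHamming_nonneg (Fin.tail a) (Fin.tail b)
    have hc0 := weightedHamming_nonneg (Fin.tail a) (Fin.tail c)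
    have hhead : a 0 = b 0 ↔ a 0 = c 0 := by
      by_contra hne
      split_ifs at h <;> first | exact hne (by tauto) | linarith
    have htail : Fin.tail b = Fin.tail c := ih (Fin.tail a) (by simp only [hhead] at h; linarith)
    have hzero : b 0 = c 0 := by revert hhead; cases a 0 <;> cases b 0 <;> cases c 0 <;> simp
    rw [← Fin.cons_self_tail b, ← Fin.cons_self_tail c, hzero, htail]

theorem weightedHamming_lt_two_inv_pow_iff (a b : Fin k → Bool) (j : ℕ) :
    weightedHamming a b < (1 / 2) ^ j ↔ ∀ i : Fin k, (i : ℕ) < j → a i = b i := by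
  induction k generalizing j with
  | zero => simp [weightedHamming]
  | succ k ih =>
    cases j with
    | zero => simpa using weightedHamming_lt_one a b
    | succ j =>
      rw [weightedHamming_succ, Fin.forall_fin_succ, pow_succ, mul_one_div,
        div_lt_div_iff_of_pos_right two_pos]
      by_cases h : a 0 = b 0
      · simpa [h, Fin.tail] using ih (Fin.tail a) (Fin.tail b) j
      · have hnonneg := weightedHamming_nonneg (Fin.tail a) (Fin.tail b)
        have hpow : (1 / 2 : ℝ) ^ j ≤ 1 := pow_le_one₀ (by norm_num) (by norm_num)
        simp only [h, if_false, Fin.val_zero, Nat.succ_pos, forall_const, false_and, iff_false]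
        linarith

lemma weightedHamming_lt_iff_take_eq {j : ℕ} (h : j ≤ k) (a b : Fin k → Bool) :
    weightedHamming a b < (1 / 2) ^ j ↔ Fin.take j h a = Fin.take j h b := by
  rw [weightedHamming_lt_two_inv_pow_iff, funext_iff]
  exact ⟨fun H i => H _ i.2, fun H i hi => H ⟨i, hi⟩⟩

lemma weightedHamming_lt_iff_eq (a b : Fin k → Bool) :
    weightedHamming a b < (1 / 2) ^ k ↔ a = b :=
  weightedHamming_lt_iff_take_eq le_rfl a b

end WeightedHamming

section Stability

variable {n k : ℕ} {M : Market n k} {μ ν : Matching n} {x y z : Person n}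

/-- The index of a participant within their own side. -/
def sideIndex : Person n → Fin n := Sum.elim id id

lemma eq_of_sideIndex_eq (hside : x.isLeft = y.isLeft) (h : sideIndex x = sideIndex y) :
    x = y := by
  cases x <;> cases y <;> simp_all [sideIndex]

lemma sideIndex_opposite (x : Person n) (j : Fin n) : sideIndex (opposite x j) = j := by
  cases x <;> rfl

lemma isLeft_opposite_ne (x : Person n) (j : Fin n) : (opposite x j).isLeft ≠ x.isLeft := by
  cases x <;> simp [opposite]

lemma opposite_sideIndex (h : x.isLeft ≠ y.isLeft) : opposite x (sideIndex y) = y :=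
  eq_of_sideIndex_eq (by grind [isLeft_opposite_ne]) (sideIndex_opposite x _)

lemma personDist_comm (a : Profiles n k) (x y : Person n) : personDist a x y = personDist a y x :=
  weightedHamming_comm _ _

/-- The strict preferences of `x` as a score in lexicographic order, smaller being better: first
the distance, then the position in the tie-breaking list. -/
noncomputable def rankKey (M : Market n k) (x y : Person n) : ℝ ×ₗ Fin n :=
  toLex (personDist M.1 x y, M.2 x (sideIndex y))

lemma rankKey_injective (hside : y.isLeft = z.isLeft) (h : rankKey M x y = rankKey M x z) :
    y = z :=
  eq_of_sideIndex_eq hside ((M.2 x).injective (congrArg (fun r => (ofLex r).2) h))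

lemma personDist_le_of_rankKey_le (h : rankKey M x y ≤ rankKey M x z) :
    personDist M.1 x y ≤ personDist M.1 x z :=
  Prod.Lex.monotone_fst _ _ h

lemma prefers_iff_rankKey_lt {i j : Fin n} :
    Prefers M x i j ↔ rankKey M x (opposite x i) < rankKey M x (opposite x j) := by
  simp only [Prefers, rankKey, Prod.Lex.toLex_lt_toLex, sideIndex_opposite]

lemma wouldSwitch_iff_rankKey_lt (hxy : x.isLeft ≠ y.isLeft)
    (hx : (μ.toFun x).isLeft ≠ x.isLeft) :
    WouldSwitch M μ x (sideIndex y) ↔ rankKey M x y < rankKey M x (μ.toFun x) := by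
  simp only [WouldSwitch, prefers_iff_rankKey_lt, opposite_sideIndex hxy]
  exact ⟨fun h => opposite_sideIndex hx.symm ▸ h _ (opposite_sideIndex hx.symm).symm,
    fun h i hi => hi ▸ h⟩

lemma Matching.involutive (μ : Matching n) : μ.toFun.Involutive := fun x => μ.symm x _ rfl

lemma Matching.apply_eq_self_of_isLeft_eq (μ : Matching n)
    (h : (μ.toFun x).isLeft = x.isLeft) : μ.toFun x = x :=
  (μ.self_or_opposite x).resolve_right fun ⟨j, hj⟩ => isLeft_opposite_ne x j (hj ▸ h)

/-- The matching of all participants in which man `i` marries woman `σ i`. -/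
def Matching.ofPerm (σ : Equiv.Perm (Fin n)) : Matching n where
  toFun := Sum.elim (Sum.inr ∘ σ) (Sum.inl ∘ σ.symm)
  self_or_opposite := by rintro (i | j) <;> exact Or.inr ⟨_, rfl⟩
  symm := by rintro (i | j) _ rfl <;> simp

theorem exists_isStable (M : Market n k) : ∃ μ : Matching n, IsStable M μ := by
  obtain ⟨σ, hσ⟩ := exists_stable_equiv rfl
    (p := fun i j => rankKey M (Sum.inl i) (Sum.inr j))
    (q := fun j i => rankKey M (Sum.inr j) (Sum.inl i))
    (fun i _ _ h => Sum.inr_injective (rankKey_injective rfl h))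
    (fun j _ _ h => Sum.inl_injective (rankKey_injective rfl h))
  refine ⟨.ofPerm σ, fun i j ⟨hi, hj⟩ => ?_⟩
  exact (hσ i j).elim (prefers_iff_rankKey_lt.1 (hi (σ i) rfl)).not_ge
    (prefers_iff_rankKey_lt.1 (hj (σ.symm j) rfl)).not_ge

lemma IsStable.not_wouldSwitch_and (hμ : IsStable M μ) (hxy : x.isLeft ≠ y.isLeft) :
    ¬(WouldSwitch M μ x (sideIndex y) ∧ WouldSwitch M μ y (sideIndex x)) := by
  rcases x with i | j <;> rcases y with i' | j'
  · simp at hxy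
  · exact hμ i j'
  · exact fun h => hμ i' j h.symm
  · simp at hxy

theorem IsStable.isLeft_apply_ne (hμ : IsStable M μ) (x : Person n) :
    (μ.toFun x).isLeft ≠ x.isLeft := by
  intro hside
  have hx : μ.toFun x = x := μ.apply_eq_self_of_isLeft_eq hside
  have hself : ∀ z, μ.toFun z = z → ∀ i, WouldSwitch M μ z i := fun z hz i l hl =>
    absurd (congrArg Sum.isLeft (hl.symm.trans hz)) (isLeft_opposite_ne z l)
  have hmatched : ∀ j, (μ.toFun (opposite x j)).isLeft = x.isLeft := fun j => by
    have hne := isLeft_opposite_ne x j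
    by_contra h
    have hy := μ.apply_eq_self_of_isLeft_eq (x := opposite x j) (by grind)
    exact hμ.not_wouldSwitch_and hne.symm ⟨hself x hx _, hself _ hy _⟩
  have hinj : (fun j => sideIndex (μ.toFun (opposite x j))).Injective := fun i j h => by
    have := μ.involutive.injective (eq_of_sideIndex_eq (by rw [hmatched, hmatched]) h)
    rw [← sideIndex_opposite x i, this, sideIndex_opposite]
  obtain ⟨j, hj⟩ := Finite.surjective_of_injective hinj (sideIndex x)
  have hself_partner : opposite x j = x :=
    (μ.symm _ _ (eq_of_sideIndex_eq (hmatched j) hj)).symm.trans hx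
  exact isLeft_opposite_ne x j (congrArg Sum.isLeft hself_partner)

theorem IsStable.rankKey_le_or (hμ : IsStable M μ) (hxy : x.isLeft ≠ y.isLeft) :
    rankKey M x (μ.toFun x) ≤ rankKey M x y ∨ rankKey M y (μ.toFun y) ≤ rankKey M y x := by
  have h := hμ.not_wouldSwitch_and hxy
  rw [wouldSwitch_iff_rankKey_lt hxy (hμ.isLeft_apply_ne x),
    wouldSwitch_iff_rankKey_lt hxy.symm (hμ.isLeft_apply_ne y)] at h
  simpa only [not_and_or, not_lt] using h

lemma IsStable.rankKey_lt_of_partner_lt (hμ : IsStable M μ) (hν : IsStable M ν)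
    (h : rankKey M x (μ.toFun x) < rankKey M x (ν.toFun x)) :
    rankKey M (μ.toFun x) (ν.toFun (μ.toFun x)) < rankKey M (μ.toFun x) (μ.toFun (μ.toFun x)) := by
  have hne := hμ.isLeft_apply_ne x
  rw [μ.involutive x]
  refine ((hν.rankKey_le_or hne.symm).resolve_left h.not_ge).lt_of_ne fun heq => ?_
  have hνμ : ν.toFun (μ.toFun x) = x :=
    rankKey_injective (by have := hν.isLeft_apply_ne (μ.toFun x); grind) heq
  exact h.ne (congrArg (rankKey M x) (ν.symm _ _ hνμ).symm)

theorem IsStable.personDist_eq (hμ : IsStable M μ) (hν : IsStable M ν) (x : Person n) :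
    personDist M.1 x (μ.toFun x) = personDist M.1 x (ν.toFun x) := by
  have hlt : ∀ {μ ν : Matching n}, IsStable M μ → IsStable M ν →
      ∀ x, rankKey M x (μ.toFun x) < rankKey M x (ν.toFun x) →
      personDist M.1 x (μ.toFun x) = personDist M.1 x (ν.toFun x) := by
    intro μ ν hμ hν x hx
    refine eq_of_forall_le_of_involutive (personDist_comm M.1) μ.involutive ν.involutive
      (A := {x | rankKey M x (μ.toFun x) < rankKey M x (ν.toFun x)})
      (B := {x | rankKey M x (ν.toFun x) < rankKey M x (μ.toFun x)})
      ?_ ?_ ?_ ?_ x (by simpa only [Finset.mem_filter_univ] using hx)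
    all_goals simp only [Finset.mem_filter_univ]
    · exact fun _ => hμ.rankKey_lt_of_partner_lt hν
    · exact fun _ => hν.rankKey_lt_of_partner_lt hμ
    · exact fun _ h => personDist_le_of_rankKey_le h.le
    · exact fun _ h => personDist_le_of_rankKey_le h.le
  rcases lt_trichotomy (rankKey M x (μ.toFun x)) (rankKey M x (ν.toFun x)) with h | h | h
  · exact hlt hμ hν x h
  · exact congrArg (fun r => (ofLex r).1) h
  · exact (hlt hν hμ x h).symm

theorem IsStable.personDist_eq_matchingDistance (hμ : IsStable M μ) (x : Person n) :
    personDist M.1 x (μ.toFun x) = matchingDistance M x := by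
  have hex : ∃ μ, IsStable M μ := ⟨μ, hμ⟩
  rw [matchingDistance, dif_pos hex]
  exact hμ.personDist_eq hex.choose_spec x

lemma IsStable.profile_eq (hμ : IsStable M μ) (hν : IsStable M ν) (x : Person n) :
    M.1 (μ.toFun x) = M.1 (ν.toFun x) :=
  weightedHamming_right_injective _ (hμ.personDist_eq hν x)

lemma prefers_iff_personDist_lt (h : M.1.Injective) {i j : Fin n} :
    Prefers M x i j ↔ personDist M.1 x (opposite x i) < personDist M.1 x (opposite x j) := by
  refine or_iff_left fun ⟨heq, hlt⟩ => hlt.ne (congrArg (M.2 x) ?_)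
  rw [← sideIndex_opposite x i, h (weightedHamming_right_injective _ heq), sideIndex_opposite]

theorem uniqueWithoutTieBreaking_of_injective {a : Profiles n k} (h : a.Injective) :
    UniqueWithoutTieBreaking a := by
  obtain ⟨μ, hμ⟩ := exists_isStable (a, fun _ => 1)
  refine ⟨μ, fun T ν => ?_⟩
  have hstable : IsStable (a, T) ν ↔ IsStable (a, fun _ => 1) ν := by
    simp only [IsStable, IsBlockingPair, WouldSwitch,
      prefers_iff_personDist_lt (M := (a, _)) h]
  rw [hstable]
  exact ⟨fun hν => Matching.ext (funext fun x => h (hν.profile_eq hμ x)), fun hν => hν ▸ hμ⟩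

end Stability

section UniformAverages

open scoped BigOperators

lemma uniformProb_eq_expect {Ω : Type} [Fintype Ω] (A : Set Ω) :
    uniformProb A = 𝔼 ω, A.indicator (1 : Ω → ℝ) ω := by
  classical
  rw [uniformProb, Fintype.expect_eq_sum_div_card, Nat.card_eq_fintype_card,
    Set.ncard_eq_toFinset_card', ← Set.filter_mem_univ_eq_toFinset]
  simp [Set.indicator_apply]

lemma uniformProb_le_one {Ω : Type} [Finite Ω] (A : Set Ω) : uniformProb A ≤ 1 :=
  div_le_one_of_le₀ (mod_cast Set.ncard_le_card A) (Nat.cast_nonneg _)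

theorem one_sub_expect_le_uniformProb {Ω : Type} [Fintype Ω] [Nonempty Ω] {A : Set Ω}
    {f : Ω → ℝ} (hf : ∀ ω, 0 ≤ f ω) (hA : ∀ ω ∉ A, 1 ≤ f ω) : 1 - 𝔼 ω, f ω ≤ uniformProb A := by
  rw [uniformProb_eq_expect, sub_le_iff_le_add', ← Finset.expect_add_distrib]
  refine (Fintype.expect_const (1 : ℝ)).ge.trans (Finset.expect_le_expect fun ω _ => ?_)
  by_cases hω : ω ∈ A
  · simpa [hω] using hf ω
  · simpa [hω] using hA ω hω

section Expect

variable {α β ι κ E : Type*} [Fintype α] [Fintype β] [Fintype ι] [Fintype κ]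
  [AddCommMonoid E] [Module ℚ≥0 E]

lemma expect_prod_fst [Nonempty β] (f : α → E) : 𝔼 p : α × β, f p.1 = 𝔼 a, f a := by
  rw [← Finset.univ_product_univ, Finset.expect_product]
  simp only [Fintype.expect_const]

theorem expect_comp_embedding [DecidableEq ι] [DecidableEq κ] [Nonempty α] (e : ι ↪ κ)
    (f : (ι → α) → E) : 𝔼 b : κ → α, f (b ∘ e) = 𝔼 p, f p := by
  classical
  let split := (Equiv.piEquivPiSubtypeProd (· ∈ Set.range e) fun _ => α).trans
    (((Equiv.ofInjective e e.injective).arrowCongr (.refl α)).symm.prodCongr (.refl _))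
  rw [← expect_prod_fst (β := {i // i ∉ Set.range e} → α) f]
  exact Fintype.expect_equiv split _ _ fun b => rfl

lemma expect_apply_apply [DecidableEq κ] [Nonempty α] {x y : κ} (h : x ≠ y) (g : α → α → E) :
    𝔼 a : κ → α, g (a x) (a y) = 𝔼 b, 𝔼 c, g b c := by
  let e : Fin 2 ↪ κ :=
    ⟨![x, y], by simpa [Function.Injective, Fin.forall_fin_two] using ⟨h, h.symm⟩⟩
  rw [← Finset.expect_product', Finset.univ_product_univ]
  refine (expect_comp_embedding e fun p => g (p 0) (p 1)).trans ?_
  exact Fintype.expect_equiv (finTwoArrowEquiv α) _ _ fun p => rfl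

lemma expect_take [Nonempty α] {j k : ℕ} (h : j ≤ k) (f : (Fin j → α) → E) :
    𝔼 b : Fin k → α, f (Fin.take j h b) = 𝔼 p, f p :=
  expect_comp_embedding (Fin.castLEEmb h) f

end Expect

/-- The cross terms of the squares cancel on average, because distinct coordinates of `a` are
independent and `s` sums to `0`. -/
theorem expect_sum_sq_sum_le {V B C : Type*} [Fintype V] [DecidableEq V] [Fintype B] [Nonempty B]
    [Fintype C] [DecidableEq C] {s : V → ℝ} (hs : ∑ x, s x = 0) (f : B → C) :
    𝔼 a : V → B, ∑ c, (∑ x with f (a x) = c, s x) ^ 2 ≤ ∑ x, s x ^ 2 := by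
  let r : ℝ := 𝔼 b, 𝔼 c, if f b = f c then 1 else 0
  have hr : 0 ≤ r :=
    Finset.expect_nonneg fun _ _ => Finset.expect_nonneg fun _ _ => by split_ifs <;> norm_num
  have hexpand : ∀ a : V → B, ∑ c, (∑ x with f (a x) = c, s x) ^ 2 =
      ∑ x, ∑ y, s x * s y * if f (a x) = f (a y) then 1 else 0 := fun a => by
    simp only [Finset.sum_filter, sq, Finset.sum_mul_sum]
    rw [Finset.sum_comm]
    refine Finset.sum_congr rfl fun x _ => ?_
    rw [Finset.sum_comm]
    simp [eq_comm]
  have hpair : ∀ x y, 𝔼 a : V → B, s x * s y * (if f (a x) = f (a y) then 1 else 0) =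
      s x * s y * r + if x = y then s x ^ 2 * (1 - r) else 0 := fun x y => by
    rw [← Finset.mul_expect]
    obtain rfl | hxy := eq_or_ne x y
    · simp only [if_true, Fintype.expect_const]; ring
    · rw [expect_apply_apply hxy fun b c => if f b = f c then (1 : ℝ) else 0, if_neg hxy, add_zero]
  simp only [hexpand, Finset.expect_sum_comm, hpair, Finset.sum_add_distrib, ← Finset.sum_mul,
    ← Finset.sum_mul_sum, hs, Finset.sum_ite_eq, Finset.mem_univ, if_true]
  nlinarith [Finset.sum_nonneg fun x (_ : x ∈ Finset.univ) => sq_nonneg (s x)]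

end UniformAverages

section RandomProfiles

open scoped BigOperators Finset

variable {n k i j : ℕ}

lemma personDist_lt_iff_take_eq (h : j ≤ k) (a : Profiles n k) (x y : Person n) :
    personDist a x y < (1 / 2) ^ j ↔ Fin.take j h (a x) = Fin.take j h (a y) :=
  weightedHamming_lt_iff_take_eq h _ _

lemma expect_personDist_lt (hj : j ≤ k) {x y : Person n} (hxy : x ≠ y) :
    𝔼 a : Profiles n k, (if personDist a x y < (1 / 2) ^ j then 1 else 0 : ℝ) = 1 / 2 ^ j := by
  let same (b c : Fin k → Bool) : ℝ := if Fin.take j hj b = Fin.take j hj c then 1 else 0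
  have hfix : ∀ b, 𝔼 c, same b c = 1 / 2 ^ j := fun b => by
    rw [expect_take hj fun p => if Fin.take j hj b = p then (1 : ℝ) else 0,
      Fintype.expect_eq_sum_div_card]
    simp
  simp only [personDist_lt_iff_take_eq hj]
  exact (expect_apply_apply hxy same).trans (by simp only [hfix, Fintype.expect_const])

/-- The ordered pairs of distinct participants at distance less than `2⁻ʲ`. -/
noncomputable def closePairs (j : ℕ) (a : Profiles n k) : Finset (Person n × Person n) :=
  {p ∈ Finset.univ.offDiag | personDist a p.1 p.2 < (1 / 2) ^ j}

lemma mem_closePairs {a : Profiles n k} {p : Person n × Person n} :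
    p ∈ closePairs j a ↔ p.1 ≠ p.2 ∧ personDist a p.1 p.2 < (1 / 2) ^ j := by
  simp only [closePairs, Finset.mem_filter, Finset.mem_offDiag, Finset.mem_univ, true_and]

theorem expect_card_closePairs_le (hj : j ≤ k) :
    𝔼 a : Profiles n k, (#(closePairs j a) : ℝ) ≤ (2 * n) ^ 2 / 2 ^ j := by
  have hcard : (#(Finset.univ : Finset (Person n)).offDiag : ℝ) ≤ (2 * n) ^ 2 := by
    rw [Finset.offDiag_card, Finset.card_univ, Fintype.card_sum, Fintype.card_fin, ← two_mul, sq]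
    exact_mod_cast Nat.sub_le _ _
  simp only [closePairs, Finset.card_filter, Nat.cast_sum, Nat.cast_ite, Nat.cast_one,
    Nat.cast_zero]
  rw [Finset.expect_sum_comm, Finset.sum_congr rfl fun p hp =>
    expect_personDist_lt hj (Finset.mem_offDiag.1 hp).2.2, Finset.sum_const, nsmul_eq_mul,
    mul_one_div]
  gcongr

lemma card_le_card_closePairs {a : Profiles n k} {S : Finset (Person n)}
    (hS : ∀ x ∈ S, ∃ y, x ≠ y ∧ personDist a x y < (1 / 2) ^ j) : #S ≤ #(closePairs j a) := by
  refine (Finset.card_le_card fun x hx => ?_).trans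
    (Finset.card_image_le (s := closePairs j a) (f := Prod.fst))
  obtain ⟨y, hy⟩ := hS x hx
  exact Finset.mem_image.2 ⟨(x, y), mem_closePairs.2 hy, rfl⟩

lemma closePairs_nonempty_of_not_injective {a : Profiles n k} (h : ¬a.Injective) :
    (closePairs k a).Nonempty := by
  obtain ⟨x, y, heq, hne⟩ := Function.not_injective_iff.1 h
  exact ⟨(x, y), mem_closePairs.2 ⟨hne, (weightedHamming_lt_iff_eq _ _).2 heq⟩⟩

theorem multipleFraction_le_card_closePairs_div (M : Market n k) :
    multipleFraction M ≤ #(closePairs k M.1) / (2 * n) := by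
  classical
  obtain ⟨μ, hμ⟩ := exists_isStable M
  rw [multipleFraction, Set.ncard_eq_toFinset_card',
    ← Finset.card_image_of_injective _ μ.involutive.injective]
  gcongr
  refine card_le_card_closePairs fun z hz => ?_
  obtain ⟨x, hx, rfl⟩ := Finset.mem_image.1 hz
  obtain ⟨j, ⟨ν, hν, hj⟩, hne⟩ := (Set.mem_toFinset.1 hx).exists_ne (sideIndex (μ.toFun x))
  refine ⟨ν.toFun x, fun heq => hne ?_, (weightedHamming_lt_iff_eq _ _).2 (hμ.profile_eq hν x)⟩
  rw [heq, hj, sideIndex_opposite]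

lemma card_matchingDistance_lt_le (j : ℕ) (M : Market n k) :
    #{x | matchingDistance M x < (1 / 2) ^ j} ≤ #(closePairs j M.1) := by
  obtain ⟨μ, hμ⟩ := exists_isStable M
  refine card_le_card_closePairs fun x hx => ⟨μ.toFun x, fun heq => ?_, ?_⟩
  · exact hμ.isLeft_apply_ne x (congrArg Sum.isLeft heq.symm)
  · rw [hμ.personDist_eq_matchingDistance]
    exact (Finset.mem_filter.1 hx).2

/-- `1` for men and `-1` for women. -/
def sideSign : Person n → ℝ := Sum.elim 1 (-1)

lemma abs_sideSign (x : Person n) : |sideSign x| = 1 := by cases x <;> simp [sideSign]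

lemma sideSign_congr {x y : Person n} (h : x.isLeft = y.isLeft) : sideSign x = sideSign y := by
  cases x <;> cases y <;> simp_all [sideSign]

lemma sideSign_add_eq_zero {x y : Person n} (h : x.isLeft ≠ y.isLeft) :
    sideSign x + sideSign y = 0 := by
  cases x <;> cases y <;> simp_all [sideSign]

/-- The number of men minus the number of women whose profile begins with `β`. -/
def imbalance (h : j ≤ k) (a : Profiles n k) (β : Fin j → Bool) : ℝ :=
  ∑ x with Fin.take j h (a x) = β, sideSign x

theorem expect_sum_imbalance_sq_le (h : j ≤ k) :
    𝔼 a : Profiles n k, ∑ β, imbalance h a β ^ 2 ≤ 2 * n := by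
  have hzero : ∑ x : Person n, sideSign x = 0 := by simp [sideSign]
  have hsq : ∑ x : Person n, sideSign x ^ 2 = 2 * n := by simp [sideSign, two_mul]
  exact hsq ▸ expect_sum_sq_sum_le hzero (Fin.take j h)

lemma IsStable.isLeft_eq_of_personDist_lt {M : Market n k} {μ : Matching n} (hμ : IsStable M μ)
    {x y : Person n} (hx : personDist M.1 x y < personDist M.1 x (μ.toFun x))
    (hy : personDist M.1 x y < personDist M.1 y (μ.toFun y)) : x.isLeft = y.isLeft := by
  by_contra hxy
  rw [personDist_comm] at hy
  exact (hμ.rankKey_le_or hxy).elim (fun h => hx.not_ge (personDist_le_of_rankKey_le h))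
    fun h => hy.not_ge (personDist_le_of_rankKey_le h)

/-- Participants matched within distance `2⁻ʲ` share their first `j` bits with their partners. -/
lemma sum_sideSign_near_eq_zero (h : j ≤ k) (M : Market n k) (β : Fin j → Bool) :
    ∑ x with Fin.take j h (M.1 x) = β ∧ ¬(1 / 2) ^ j ≤ matchingDistance M x, sideSign x = 0 := by
  obtain ⟨μ, hμ⟩ := exists_isStable M
  refine Finset.sum_involution (fun x _ => μ.toFun x)
    (fun x _ => sideSign_add_eq_zero (hμ.isLeft_apply_ne x).symm)
    (fun x _ _ heq => hμ.isLeft_apply_ne x (congrArg Sum.isLeft heq)) (fun x hx => ?_)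
    fun x _ => μ.involutive x
  simp only [Finset.mem_filter_univ, not_le, ← hμ.personDist_eq_matchingDistance,
    μ.involutive x] at hx ⊢
  rw [personDist_comm M.1 (μ.toFun x)]
  exact ⟨((personDist_lt_iff_take_eq h _ _ _).1 hx.2).symm.trans hx.1, hx.2⟩

/-- Participants with the same first `j` bits matched at distance at least `2⁻ʲ` prefer each other
to their partners, so they are on the same side. -/
theorem card_far_le_abs_imbalance (h : j ≤ k) (M : Market n k) (β : Fin j → Bool) :
    (#{x | Fin.take j h (M.1 x) = β ∧ (1 / 2) ^ j ≤ matchingDistance M x} : ℝ) ≤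
      |imbalance h M.1 β| := by
  obtain ⟨μ, hμ⟩ := exists_isStable M
  set F : Finset (Person n) :=
    {x | Fin.take j h (M.1 x) = β ∧ (1 / 2) ^ j ≤ matchingDistance M x} with hF
  have himbalance : imbalance h M.1 β = ∑ x ∈ F, sideSign x := by
    rw [imbalance, ← Finset.sum_filter_add_sum_filter_not _
      fun x => (1 / 2) ^ j ≤ matchingDistance M x]
    simp only [Finset.filter_filter, sum_sideSign_near_eq_zero, add_zero, hF]
  obtain hempty | ⟨x, hx⟩ := F.eq_empty_or_nonempty
  · simp [hempty]
  have hsame : ∀ y ∈ F, sideSign y = sideSign x := fun y hy => by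
    simp only [hF, Finset.mem_filter_univ, ← hμ.personDist_eq_matchingDistance] at hx hy
    have hyx := (personDist_lt_iff_take_eq h M.1 y x).2 (hy.1.trans hx.1.symm)
    exact sideSign_congr (hμ.isLeft_eq_of_personDist_lt (hyx.trans_le hy.2) (hyx.trans_le hx.2))
  rw [himbalance, Finset.sum_congr rfl hsame, Finset.sum_const, nsmul_eq_mul, abs_mul,
    abs_sideSign, mul_one, Nat.abs_cast]

theorem card_le_matchingDistance_sq_le (h : j ≤ k) (M : Market n k) :
    (#{x | (1 / 2) ^ j ≤ matchingDistance M x} : ℝ) ^ 2 ≤ 2 ^ j * ∑ β, imbalance h M.1 β ^ 2 := by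
  have hfiber : (#{x | (1 / 2) ^ j ≤ matchingDistance M x} : ℝ) = ∑ β : Fin j → Bool,
      (#{x | Fin.take j h (M.1 x) = β ∧ (1 / 2) ^ j ≤ matchingDistance M x} : ℝ) := by
    rw [Finset.card_eq_sum_card_fiberwise (f := fun x => Fin.take j h (M.1 x))
      (t := Finset.univ) fun _ _ => Finset.mem_univ _]
    simp only [Finset.filter_filter, Nat.cast_sum, and_comm]
  rw [hfiber]
  refine sq_sum_le_card_mul_sum_sq.trans ?_
  simp only [Finset.card_univ, Fintype.card_fun, Fintype.card_bool, Fintype.card_fin, Nat.cast_pow,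
    Nat.cast_ofNat]
  refine mul_le_mul_of_nonneg_left (Finset.sum_le_sum fun β _ => ?_) (by positivity)
  exact (pow_le_pow_left₀ (Nat.cast_nonneg _) (card_far_le_abs_imbalance h M β) 2).trans_eq
    (sq_abs _)

theorem one_sub_le_uniformProb_multipleFraction (hn : 0 < n) {δ : ℝ} (hδ : 0 < δ) :
    1 - 2 * n / 2 ^ k / δ ≤ uniformProb {M : Market n k | multipleFraction M < δ} := by
  have hmean : 𝔼 M : Market n k, (#(closePairs k M.1) : ℝ) / (2 * n) / δ ≤ 2 * n / 2 ^ k / δ := by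
    rw [expect_prod_fst fun a : Profiles n k => (#(closePairs k a) : ℝ) / (2 * n) / δ]
    simp only [← Finset.expect_div]
    refine div_le_div_of_nonneg_right ((div_le_iff₀ (by positivity)).2 ?_) hδ.le
    exact (expect_card_closePairs_le le_rfl).trans_eq (by ring)
  refine (sub_le_sub_left hmean 1).trans
    (one_sub_expect_le_uniformProb (fun M => by positivity) fun M hM => (one_le_div hδ).2 ?_)
  exact (not_lt.1 hM).trans (multipleFraction_le_card_closePairs_div M)

theorem one_sub_le_uniformProb_uniqueWithoutTieBreaking :
    1 - (2 * n) ^ 2 / 2 ^ k ≤ uniformProb {M : Market n k | UniqueWithoutTieBreaking M.1} := by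
  have hmean : 𝔼 M : Market n k, (#(closePairs k M.1) : ℝ) ≤ (2 * n) ^ 2 / 2 ^ k :=
    (expect_prod_fst fun a : Profiles n k => (#(closePairs k a) : ℝ)).trans_le
      (expect_card_closePairs_le le_rfl)
  refine (sub_le_sub_left hmean 1).trans
    (one_sub_expect_le_uniformProb (fun M => Nat.cast_nonneg _) fun M hM => ?_)
  have hinj : ¬M.1.Injective := fun h => hM (uniqueWithoutTieBreaking_of_injective h)
  exact_mod_cast (closePairs_nonempty_of_not_injective hinj).card_pos

lemma expect_card_matchingDistance_lt_le (hi : i ≤ k) :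
    𝔼 M : Market n k, (#{x | matchingDistance M x < (1 / 2) ^ i} : ℝ) ≤ (2 * n) ^ 2 / 2 ^ i :=
  calc 𝔼 M : Market n k, (#{x | matchingDistance M x < (1 / 2) ^ i} : ℝ)
    _ ≤ 𝔼 M : Market n k, (#(closePairs i M.1) : ℝ) :=
      Finset.expect_le_expect fun M _ => mod_cast card_matchingDistance_lt_le i M
    _ = 𝔼 a : Profiles n k, (#(closePairs i a) : ℝ) :=
      expect_prod_fst fun a : Profiles n k => (#(closePairs i a) : ℝ)
    _ ≤ (2 * n) ^ 2 / 2 ^ i := expect_card_closePairs_le hi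

lemma expect_card_le_matchingDistance_le (hj : j ≤ k) :
    𝔼 M : Market n k, (#{x | (1 / 2) ^ j ≤ matchingDistance M x} : ℝ) ≤ √(2 ^ j * (2 * n)) := by
  refine Real.le_sqrt_of_sq_le ?_
  calc (𝔼 M : Market n k, (#{x | (1 / 2) ^ j ≤ matchingDistance M x} : ℝ)) ^ 2
    _ ≤ 𝔼 M : Market n k, (#{x | (1 / 2) ^ j ≤ matchingDistance M x} : ℝ) ^ 2 := by
      simpa using Finset.expect_mul_sq_le_sq_mul_sq Finset.univ
        (fun M : Market n k => (#{x | (1 / 2) ^ j ≤ matchingDistance M x} : ℝ)) 1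
    _ ≤ 𝔼 M : Market n k, 2 ^ j * ∑ β, imbalance hj M.1 β ^ 2 :=
      Finset.expect_le_expect fun M _ => card_le_matchingDistance_sq_le hj M
    _ = 2 ^ j * 𝔼 a : Profiles n k, ∑ β, imbalance hj a β ^ 2 := by
      rw [← Finset.mul_expect,
        expect_prod_fst fun a : Profiles n k => ∑ β, imbalance hj a β ^ 2]
    _ ≤ 2 ^ j * (2 * n) := by gcongr; exact expect_sum_imbalance_sq_le hj

theorem one_sub_le_uniformProb_matchingDistance (hn : 0 < n) (hi : i ≤ k) (hj : j ≤ k) :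
    1 - (2 * n / 2 ^ i + √(2 ^ j / (2 * n))) ≤ uniformProb {p : Market n k × Person n |
      (1 / 2) ^ i ≤ matchingDistance p.1 p.2 ∧ matchingDistance p.1 p.2 < (1 / 2) ^ j} := by
  have : Nonempty (Person n) := ⟨Sum.inl ⟨0, hn⟩⟩
  have hn' : (0 : ℝ) < 2 * n := by positivity
  have hmean (A : Market n k → Finset (Person n)) :
      𝔼 p : Market n k × Person n, (if p.2 ∈ A p.1 then 1 else 0 : ℝ) =
        (𝔼 M, (#(A M) : ℝ)) / (2 * n) := by
    rw [← Finset.univ_product_univ, Finset.expect_product, Finset.expect_div]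
    simp [Fintype.expect_eq_sum_div_card, two_mul]
  let near (M : Market n k) : Finset (Person n) := {x | matchingDistance M x < (1 / 2) ^ i}
  let far (M : Market n k) : Finset (Person n) := {x | (1 / 2) ^ j ≤ matchingDistance M x}
  have hbound : 𝔼 p : Market n k × Person n,
      ((if p.2 ∈ near p.1 then 1 else 0) + (if p.2 ∈ far p.1 then 1 else 0) : ℝ) ≤
        2 * n / 2 ^ i + √(2 ^ j / (2 * n)) := by
    rw [Finset.expect_add_distrib, hmean, hmean]
    refine add_le_add ((div_le_iff₀ hn').2 ?_) ((div_le_iff₀ hn').2 ?_)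
    · exact (expect_card_matchingDistance_lt_le hi).trans_eq (by ring)
    · refine (expect_card_le_matchingDistance_le hj).trans_eq ?_
      calc √(2 ^ j * (2 * n)) = √(2 ^ j / (2 * n) * (2 * n) ^ 2) := by congr 1; field_simp
        _ = √(2 ^ j / (2 * n)) * (2 * n) := by
          rw [Real.sqrt_mul' _ (sq_nonneg _), Real.sqrt_sq hn'.le]
  refine (sub_le_sub_left hbound 1).trans
    (one_sub_expect_le_uniformProb (fun p => by split_ifs <;> norm_num) fun p hp => ?_)
  have hcases : p.2 ∈ near p.1 ∨ p.2 ∈ far p.1 := by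
    simpa only [near, far, Finset.mem_filter_univ, Set.mem_ofPred_eq, not_and_or, not_le, not_lt]
      using hp
  rcases hcases with h | h <;> simp only [h, if_true] <;> split_ifs <;> norm_num

end RandomProfiles

section Asymptotics

lemma uniformProb_mono {Ω : Type} [Finite Ω] {A B : Set Ω} (h : A ⊆ B) :
    uniformProb A ≤ uniformProb B :=
  div_le_div_of_nonneg_right (mod_cast Set.ncard_le_ncard h) (Nat.cast_nonneg _)

lemma tendsto_uniformProb_one {ι : Type*} {l : Filter ι} {Ω : ι → Type} [∀ i, Finite (Ω i)]
    {A : ∀ i, Set (Ω i)} {f : ι → ℝ} (hf : Tendsto f l (𝓝 0))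
    (h : ∀ᶠ i in l, 1 - f i ≤ uniformProb (A i)) : Tendsto (fun i => uniformProb (A i)) l (𝓝 1) :=
  tendsto_of_tendsto_of_tendsto_of_le_of_le' (by simpa using hf.const_sub 1) tendsto_const_nhds h
    (Eventually.of_forall fun _ => uniformProb_le_one _)

lemma abs_log_div_log_add_one_le {x X η : ℝ} (hx : 1 < x) (hlower : x ^ (-(1 + η)) ≤ X)
    (hupper : X ≤ x ^ (-(1 - η))) : |Real.log X / Real.log x - (-1)| ≤ η := by
  have hx0 : 0 < x := one_pos.trans hx
  have hX : 0 < X := (Real.rpow_pos_of_pos hx0 _).trans_le hlower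
  have hlog_lower := Real.log_le_log (Real.rpow_pos_of_pos hx0 _) hlower
  have hlog_upper := Real.log_le_log hX hupper
  rw [Real.log_rpow hx0] at hlog_lower hlog_upper
  have hdiv_lower := (le_div_iff₀ (Real.log_pos hx)).2 hlog_lower
  have hdiv_upper := (div_le_iff₀ (Real.log_pos hx)).2 hlog_upper
  rw [abs_le]
  constructor <;> linarith

lemma two_mul_div_two_pow_min_le {x η : ℝ} {i k : ℕ} (hx : 0 < x) (hi : x ^ (1 + η) < 2 ^ (i + 1)) :
    2 * x / 2 ^ min k i ≤ 2 * (x / 2 ^ k) + 4 * x ^ (-η) := by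
  have hdiv : x / 2 ^ i ≤ 2 * x ^ (-η) := by
    rw [Real.rpow_add hx, Real.rpow_one, pow_succ] at hi
    rw [div_le_iff₀ (by positivity), Real.rpow_neg hx.le, mul_right_comm, ← div_eq_mul_inv,
      le_div_iff₀ (by positivity), mul_comm 2]
    exact hi.le
  rcases min_choice k i with h | h <;> rw [h, mul_div_assoc]
  · have : 0 ≤ x ^ (-η) := by positivity
    linarith
  · have : 0 ≤ x / 2 ^ k := by positivity
    linarith

theorem one_sub_le_uniformProb_log_matchingDistance {n k : ℕ} {η : ℝ} (hn : 1 < n)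
    (hk : (n : ℝ) < 2 ^ k) (hη : 0 ≤ η) (hη1 : η ≤ 1) :
    1 - (2 * (n / 2 ^ k) + 4 * (n : ℝ) ^ (-η) + √((n : ℝ) ^ (-η))) ≤
      uniformProb {p : Market n k × Person n | 0 < matchingDistance p.1 p.2 ∧
        |Real.log (matchingDistance p.1 p.2) / Real.log n - (-1)| ≤ η} := by
  have hn1 : (1 : ℝ) < n := mod_cast hn
  have hn0 : (0 : ℝ) < n := one_pos.trans hn1
  obtain ⟨i, hi_le, hi_lt⟩ := exists_nat_pow_near
    (Real.one_le_rpow hn1.le (by linarith : 0 ≤ 1 + η)) one_lt_two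
  obtain ⟨j, hj_le, hj_lt⟩ := exists_nat_pow_near
    (Real.one_le_rpow hn1.le (by linarith : 0 ≤ 1 - η)) one_lt_two
  have hjk : j < k := by
    have hpow : (2 : ℝ) ^ j < 2 ^ k := calc
      (2 : ℝ) ^ j ≤ (n : ℝ) ^ (1 - η) := hj_le
      _ ≤ (n : ℝ) ^ (1 : ℝ) := Real.rpow_le_rpow_of_exponent_le hn1.le (by linarith)
      _ < 2 ^ k := by rwa [Real.rpow_one]
    exact (pow_lt_pow_iff_right₀ one_lt_two).1 hpow
  have hfar : (2 : ℝ) ^ (j + 1) / (2 * n) ≤ (n : ℝ) ^ (-η) := by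
    rw [pow_succ', mul_div_mul_left _ _ two_ne_zero, div_le_iff₀ hn0]
    rwa [sub_eq_neg_add, Real.rpow_add hn0, Real.rpow_one] at hj_le
  have herror := add_le_add (two_mul_div_two_pow_min_le (k := k) hn0 hi_lt) (Real.sqrt_le_sqrt hfar)
  refine (sub_le_sub_left herror 1).trans
    ((one_sub_le_uniformProb_matchingDistance (one_pos.trans hn) (min_le_left k i) hjk).trans
      (uniformProb_mono ?_))
  rintro p ⟨hlower, hupper⟩
  refine ⟨lt_of_lt_of_le (by positivity) hlower,
    abs_log_div_log_add_one_le hn1 (hlower.trans' ?_) (hupper.le.trans ?_)⟩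
  · rw [Real.rpow_neg hn0.le, one_div, inv_pow]
    refine inv_anti₀ (by positivity) (hi_le.trans' ?_)
    exact pow_le_pow_right₀ one_le_two (min_le_right k i)
  · rw [Real.rpow_neg hn0.le, one_div, inv_pow]
    exact inv_anti₀ (by positivity) hj_lt.le

lemma tendsto_natCast_rpow_neg_atTop {η : ℝ} (hη : 0 < η) :
    Tendsto (fun n : ℕ => (n : ℝ) ^ (-η)) atTop (𝓝 0) :=
  (tendsto_rpow_neg_atTop hη).comp tendsto_natCast_atTop_atTop

lemma tendsto_pow_div_two_pow {ε : ℝ} (hε : 0 < ε) {m : ℕ} {k : ℕ → ℕ}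
    (hk : ∀ᶠ n : ℕ in atTop, (m + ε) * Real.logb 2 n < k n) :
    Tendsto (fun n : ℕ => (n : ℝ) ^ m / 2 ^ k n) atTop (𝓝 0) := by
  refine squeeze_zero' (Eventually.of_forall fun n => by positivity) ?_
    (tendsto_natCast_rpow_neg_atTop hε)
  filter_upwards [hk, eventually_gt_atTop 0] with n hkn hn
  have hn0 : (0 : ℝ) < n := mod_cast hn
  rw [← Real.logb_rpow_eq_mul_logb_of_pos hn0, Real.logb_lt_iff_lt_rpow one_lt_two (by positivity),
    Real.rpow_natCast, Real.rpow_add hn0, Real.rpow_natCast] at hkn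
  rw [div_le_iff₀ (by positivity), Real.rpow_neg hn0.le, ← div_eq_inv_mul,
    le_div_iff₀ (by positivity)]
  exact hkn.le

variable {k : ℕ → ℕ} {δ : ℝ}

theorem tendsto_uniformProb_multipleFraction
    (hk : Tendsto (fun n : ℕ => (n : ℝ) / 2 ^ k n) atTop (𝓝 0)) (hδ : 0 < δ) :
    Tendsto (fun n : ℕ => uniformProb {M : Market n (k n) | multipleFraction M < δ})
      atTop (𝓝 1) := by
  refine tendsto_uniformProb_one (f := fun n => 2 * n / 2 ^ k n / δ) ?_ ?_
  · simpa [mul_div_assoc] using (hk.const_mul 2).div_const δ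
  · filter_upwards [eventually_gt_atTop 0] with n hn
    exact one_sub_le_uniformProb_multipleFraction hn hδ

theorem tendsto_uniformProb_uniqueWithoutTieBreaking
    (hk : Tendsto (fun n : ℕ => (n : ℝ) ^ 2 / 2 ^ k n) atTop (𝓝 0)) :
    Tendsto (fun n : ℕ => uniformProb {M : Market n (k n) | UniqueWithoutTieBreaking M.1})
      atTop (𝓝 1) := by
  refine tendsto_uniformProb_one (f := fun n => (2 * n) ^ 2 / 2 ^ k n) ?_
    (Eventually.of_forall fun n => one_sub_le_uniformProb_uniqueWithoutTieBreaking)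
  simpa [mul_pow, mul_div_assoc] using hk.const_mul (2 ^ 2)

theorem tendsto_uniformProb_log_matchingDistance
    (hk : Tendsto (fun n : ℕ => (n : ℝ) / 2 ^ k n) atTop (𝓝 0)) (hδ : 0 < δ) :
    Tendsto (fun n : ℕ => uniformProb {p : Market n (k n) × Person n |
        0 < matchingDistance p.1 p.2 ∧
        |Real.log (matchingDistance p.1 p.2) / Real.log (n : ℝ) - (-1)| < δ})
      atTop (𝓝 1) := by
  obtain ⟨η, hη, hη_lt⟩ := exists_between (lt_min one_pos hδ)
  have hlim := tendsto_natCast_rpow_neg_atTop hη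
  refine tendsto_uniformProb_one
    (f := fun n => 2 * (n / 2 ^ k n) + 4 * (n : ℝ) ^ (-η) + √((n : ℝ) ^ (-η))) ?_ ?_
  · simpa using ((hk.const_mul 2).add (hlim.const_mul 4)).add hlim.sqrt
  · filter_upwards [eventually_gt_atTop 1, hk.eventually_lt_const one_pos] with n hn hkn
    refine (one_sub_le_uniformProb_log_matchingDistance hn ((div_lt_one (by positivity)).1 hkn)
      hη.le (hη_lt.le.trans (min_le_left _ _))).trans (uniformProb_mono fun p hp => ?_)
    exact ⟨hp.1, hp.2.trans_lt (hη_lt.trans_le (min_le_right _ _))⟩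

end Asymptotics

theorem theorem3p4_general :
    (∀ (n κ : ℕ) (M : Market n κ),
      (∃ μ : Matching n, IsStable M μ) ∧
      ∀ μ : Matching n, IsStable M μ →
        ∀ x : Person n, personDist M.1 x (μ.toFun x) = matchingDistance M x) ∧
    ∀ k : ℕ → ℕ,
      (Tendsto (fun n : ℕ => (n : ℝ) / 2 ^ k n) atTop (𝓝 0) →
        (∀ δ : ℝ, 0 < δ →
          Tendsto (fun n : ℕ => uniformProb {M : Market n (k n) | multipleFraction M < δ})
            atTop (𝓝 1)) ∧
        (∀ δ : ℝ, 0 < δ →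
          Tendsto (fun n : ℕ => uniformProb {p : Market n (k n) × Person n |
              0 < matchingDistance p.1 p.2 ∧
              |Real.log (matchingDistance p.1 p.2) / Real.log (n : ℝ) - (-1)| < δ})
            atTop (𝓝 1))) ∧
      (Tendsto (fun n : ℕ => (n : ℝ) ^ 2 / 2 ^ k n) atTop (𝓝 0) →
        Tendsto (fun n : ℕ => uniformProb {M : Market n (k n) | UniqueWithoutTieBreaking M.1})
          atTop (𝓝 1)) :=
  ⟨fun _ _ M => ⟨exists_isStable M, fun _ hμ => hμ.personDist_eq_matchingDistance⟩, fun _ =>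
    ⟨fun hk => ⟨fun _ => tendsto_uniformProb_multipleFraction hk,
      fun _ => tendsto_uniformProb_log_matchingDistance hk⟩,
      tendsto_uniformProb_uniqueWithoutTieBreaking⟩⟩

theorem theorem3p4 :
    -- the matching distance is well defined for every instance
    (∀ (n κ : ℕ) (M : Market n κ),
      (∃ μ : Matching n, IsStable M μ) ∧
      ∀ μ : Matching n, IsStable M μ →
        ∀ x : Person n, personDist M.1 x (μ.toFun x) = matchingDistance M x) ∧
    ∀ (ε : ℝ), 0 < ε → ∀ (k : ℕ → ℕ),
      ((∀ᶠ n : ℕ in atTop, (1 + ε) * Real.logb 2 (n : ℝ) < (k n : ℝ)) →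
        (∀ δ : ℝ, 0 < δ →
          Tendsto (fun n : ℕ => uniformProb {M : Market n (k n) | multipleFraction M < δ})
            atTop (𝓝 1)) ∧
        (∀ δ : ℝ, 0 < δ →
          Tendsto (fun n : ℕ => uniformProb {p : Market n (k n) × Person n |
              0 < matchingDistance p.1 p.2 ∧
              |Real.log (matchingDistance p.1 p.2) / Real.log (n : ℝ) - (-1)| < δ})
            atTop (𝓝 1))) ∧
      ((∀ᶠ n : ℕ in atTop, (2 + ε) * Real.logb 2 (n : ℝ) < (k n : ℝ)) →
        Tendsto (fun n : ℕ => uniformProb {M : Market n (k n) | UniqueWithoutTieBreaking M.1})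
          atTop (𝓝 1)) := by
  refine ⟨theorem3p4_general.1, fun ε hε k => ⟨fun hk => ?_, fun hk => ?_⟩⟩
  · have hlim := tendsto_pow_div_two_pow hε (m := 1) (mod_cast hk)
    exact (theorem3p4_general.2 k).1 (by simpa only [pow_one] using hlim)
  · exact (theorem3p4_general.2 k).2 (tendsto_pow_div_two_pow hε (m := 2) (mod_cast hk))
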